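/- Let $n\ge 1$ be an integer, let $E$ be an Archimedean (real) vector lattice, and let $f_1,\dots,f_n\in E$. For a sublinear map $\phi\colon\mathbb{R}^n\to\mathbb{R}$ put $\underline{\partial}\phi(0)=\{a\in\mathbb{R}^n : \sum_{i=1}^n a_ix_i\le\phi(x)\text{ for all }x\in\mathbb{R}^n\}$; we say that $\phi(f_1,\dots,f_n)$ is defined in $E$ if $\sup_{a\in\underline{\partial}\phi(0)}\sum_{i=1}^n a_if_i$ exists in $E$, and then $\phi(f_1,\dots,f_n)$ denotes this supremum. For a superlinear map $\psi\colon\mathbb{R}^n\to\mathbb{R}$ put $\overline{\partial}\psi(0)=\{a\in\mathbb{R}^n : \sum_{i=1}^n a_ix_i\ge\psi(x)\text{ for all }x\in\mathbb{R}^n\}$; we say that $\psi(f_1,\dots,f_n)$ is defined in $E$ if $\inf_{a\in\overline{\partial}\psi(0)}\sum_{i=1}^n a_if_i$ exists in $E$, and then $\psi(f_1,\dots,f_n)$ denotes this infimum. Let $h\colon\mathbb{R}^n\to\mathbb{R}$ be a function that satisfies $h(\lambda x)=\lambda h(x)$ for all $\lambda\ge 0$ and $x\in\mathbb{R}^n$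 and is bounded on the Euclidean unit sphere of $\mathbb{R}^n$. (i) Suppose $h$ is upper semicontinuous, and let $\Phi$ and $\Xi$ be families of sublinear maps $\mathbb{R}^n\to\mathbb{R}$ such that $h(x)=\inf_{\phi\in\Phi}\phi(x)=\inf_{\xi\in\Xi}\xi(x)$ for all $x\in\mathbb{R}^n$. If $\phi(f_1,\dots,f_n)$ and $\xi(f_1,\dots,f_n)$ are defined in $E$ for every $\phi\in\Phi$ and every $\xi\in\Xi$, and $\inf_{\phi\in\Phi}\phi(f_1,\dots,f_n)$ exists in $E$, then $\inf_{\xi\in\Xi}\xi(f_1,\dots,f_n)$ exists in $E$, and $$\inf_{\phi\in\Phi}\phi(f_1,\dots,f_n)=\inf_{\xi\in\Xi}\xi(f_1,\dots,f_n).$$ (ii) Suppose $h$ is lower semicontinuous, and let $\Psi$ and $\Xi$ be families of superlinear maps $\mathbb{R}^n\to\mathbb{R}$ such that $h(x)=\sup_{\psi\in\Psi}\psi(x)=\sup_{\xi\in\Xi}\xi(x)$ for all $x\in\mathbb{R}^n$. If $\psi(f_1,\dots,f_n)$ and $\xi(f_1,\dots,f_n)$ are defined in $E$ for every $\psi\in\Psi$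 and every $\xi\in\Xi$, and $\sup_{\psi\in\Psi}\psi(f_1,\dots,f_n)$ exists in $E$, then $\sup_{\xi\in\Xi}\xi(f_1,\dots,f_n)$ exists in $E$, and $$\sup_{\psi\in\Psi}\psi(f_1,\dots,f_n)=\sup_{\xi\in\Xi}\xi(f_1,\dots,f_n).$$ -/

import Mathlib

/-- A real vector lattice (Riesz space) `E` is Archimedean when `0 ≤ k x ≤ y` for all natural
numbers `k` forces `x = 0`. (Mathlib's `Archimedean` is a different, much stronger condition on
non-linearly ordered groups: every positive element would be a strong order unit.) -/
def IsArchimedeanVL (E : Type*) [AddCommGroup E] [Lattice E] : Prop :=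
  ∀ x y : E, 0 ≤ x → (∀ k : ℕ, k • x ≤ y) → x = 0

/-- `h (λ x) = λ h x` for all `λ ∈ [0, ∞)`. -/
def IsPosHomogeneous {n : ℕ} (h : EuclideanSpace ℝ (Fin n) → ℝ) : Prop :=
  ∀ c : ℝ, 0 ≤ c → ∀ x, h (c • x) = c * h x

/-- Positively homogeneous and subadditive. -/
def IsSublinear {n : ℕ} (φ : EuclideanSpace ℝ (Fin n) → ℝ) : Prop :=
  IsPosHomogeneous φ ∧ ∀ x y, φ (x + y) ≤ φ x + φ y

/-- Positively homogeneous and superadditive. -/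
def IsSuperlinear {n : ℕ} (ψ : EuclideanSpace ℝ (Fin n) → ℝ) : Prop :=
  IsPosHomogeneous ψ ∧ ∀ x y, ψ x + ψ y ≤ ψ (x + y)

/-- `h` is bounded (above and below) on the Euclidean unit sphere. -/
def IsBoundedOnUnitSphere {n : ℕ} (h : EuclideanSpace ℝ (Fin n) → ℝ) : Prop :=
  ∃ m M : ℝ, ∀ x ∈ Metric.sphere (0 : EuclideanSpace ℝ (Fin n)) 1, m ≤ h x ∧ h x ≤ M

/-- The subdifferential of `φ` at `0`. -/
def subdifferentialZero {n : ℕ} (φ : EuclideanSpace ℝ (Fin n) → ℝ) :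
    Set (EuclideanSpace ℝ (Fin n)) :=
  {a | ∀ x : EuclideanSpace ℝ (Fin n), ∑ i, a i * x i ≤ φ x}

/-- The superdifferential of `ψ` at `0`. -/
def superdifferentialZero {n : ℕ} (ψ : EuclideanSpace ℝ (Fin n) → ℝ) :
    Set (EuclideanSpace ℝ (Fin n)) :=
  {a | ∀ x : EuclideanSpace ℝ (Fin n), ψ x ≤ ∑ i, a i * x i}

section VectorLattice

variable {E : Type*} [AddCommGroup E] [Lattice E] [Module ℝ E] {n : ℕ}

/-- For a sublinear `φ`: `g = φ(f₁, …, fₙ)`, that is, the supremum over `a` in the subdifferential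
of `φ` at `0` of `∑ i, a i • f i` exists in `E` and equals `g`. -/
def IsSublinearValue (φ : EuclideanSpace ℝ (Fin n) → ℝ) (f : Fin n → E) (g : E) : Prop :=
  IsLUB ((fun a : EuclideanSpace ℝ (Fin n) => ∑ i, a i • f i) '' subdifferentialZero φ) g

/-- For a superlinear `ψ`: `g = ψ(f₁, …, fₙ)`, that is, the infimum over `a` in the
superdifferential of `ψ` at `0` of `∑ i, a i • f i` exists in `E` and equals `g`. -/
def IsSuperlinearValue (ψ : EuclideanSpace ℝ (Fin n) → ℝ) (f : Fin n → E) (g : E) : Prop :=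
  IsGLB ((fun a : EuclideanSpace ℝ (Fin n) => ∑ i, a i • f i) '' superdifferentialZero ψ) g

/-- `φ(f₁, …, fₙ)` is defined in `E` (for sublinear `φ`). -/
def SublinearDefined (φ : EuclideanSpace ℝ (Fin n) → ℝ) (f : Fin n → E) : Prop :=
  ∃ g : E, IsSublinearValue φ f g

/-- `ψ(f₁, …, fₙ)` is defined in `E` (for superlinear `ψ`). -/
def SuperlinearDefined (ψ : EuclideanSpace ℝ (Fin n) → ℝ) (f : Fin n → E) : Prop :=
  ∃ g : E, IsSuperlinearValue ψ f g

/-- The set `{φ(f₁, …, fₙ) : φ ∈ Φ}`. -/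
def sublinearValues (Φ : Set (EuclideanSpace ℝ (Fin n) → ℝ)) (f : Fin n → E) : Set E :=
  {g | ∃ φ ∈ Φ, IsSublinearValue φ f g}

/-- The set `{ψ(f₁, …, fₙ) : ψ ∈ Ψ}`. -/
def superlinearValues (Ψ : Set (EuclideanSpace ℝ (Fin n) → ℝ)) (f : Fin n → E) : Set E :=
  {g | ∃ ψ ∈ Ψ, IsSuperlinearValue ψ f g}

end VectorLattice

/-- `Φ` is a family of sublinear maps with `h x = inf_{φ ∈ Φ} φ x` for all `x`. -/
def IsInfSublinearRep {n : ℕ} (h : EuclideanSpace ℝ (Fin n) → ℝ)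
    (Φ : Set (EuclideanSpace ℝ (Fin n) → ℝ)) : Prop :=
  (∀ φ ∈ Φ, IsSublinear φ) ∧ ∀ x, IsGLB ((fun φ => φ x) '' Φ) (h x)

/-- `Ψ` is a family of superlinear maps with `h x = sup_{ψ ∈ Ψ} ψ x` for all `x`. -/
def IsSupSuperlinearRep {n : ℕ} (h : EuclideanSpace ℝ (Fin n) → ℝ)
    (Ψ : Set (EuclideanSpace ℝ (Fin n) → ℝ)) : Prop :=
  (∀ ψ ∈ Ψ, IsSuperlinear ψ) ∧ ∀ x, IsLUB ((fun ψ => ψ x) '' Ψ) (h x)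

/-!
Both infima are determined by their lower bounds, so it is enough that every lower bound `g` of
`{ξ(f) : ξ ∈ Ξ}` satisfies `g ≤ φ(f)` for each `φ ∈ Φ`; the roles of `Φ` and `Ξ` are symmetric.

Since `inf ξ = h ≤ φ` and sublinear maps on `ℝⁿ` are continuous, compactness of the unit sphere
yields, for each `ε > 0`, finitely many `ξ` whose minimum lies below `φ x + ε ‖x‖` everywhere on the
sphere (`IsInfSublinearRep.exists_finset_lt_add`). This pointwise inequality has to be carried over
to `E`. Suprema distribute over infima in a lattice-ordered group, so `g` may be compared with
`⨅ (s ξ)(f)` for each choice of subgradients `s ξ ∈ ∂ξ(0)` instead of with `⨅ ξ(f)`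
(`le_of_forall_subgradient_choice`). For such a choice the Hahn–Banach theorem shows that the convex
hull of the `s ξ` meets the `ε`-neighbourhood of `∂φ(0)`
(`exists_mem_convexHull_add_mem_subdifferentialZero`): a separating functional would be a point `x`
at which every `ξ x` is at least `φ x + ε ‖x‖`. A convex combination `∑ w ξ • s ξ = b + d` with
`b ∈ ∂φ(0)` and `‖d‖ < ε` bounds `g` by `φ(f) + ε ∑ |f i|`, and the Archimedean property removes the
error term. The superlinear case follows by replacing `ψ` with `-ψ`.
-/

/-! ### Linear combinations of coordinates -/

/-- The linear map `a ↦ ∑ i, a i • f i`. -/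
noncomputable def coordCombination {E : Type*} [AddCommGroup E] [Module ℝ E] {n : ℕ}
    (f : Fin n → E) : EuclideanSpace ℝ (Fin n) →ₗ[ℝ] E where
  toFun a := ∑ i, a i • f i
  map_add' a b := by simp [add_smul, Finset.sum_add_distrib]
  map_smul' c a := by simp [mul_smul, Finset.smul_sum]

theorem coordCombination_apply {E : Type*} [AddCommGroup E] [Module ℝ E] {n : ℕ}
    (f : Fin n → E) (a : EuclideanSpace ℝ (Fin n)) :
    coordCombination f a = ∑ i, a i • f i := rfl

theorem exists_forall_eq_sum_mul {n : ℕ} (l : EuclideanSpace ℝ (Fin n) →ₗ[ℝ] ℝ) :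
    ∃ x : EuclideanSpace ℝ (Fin n), ∀ a, l a = ∑ i, a i * x i := by
  refine ⟨(InnerProductSpace.toDual ℝ _).symm l.toContinuousLinearMap, fun a => ?_⟩
  have h := InnerProductSpace.toDual_symm_apply (𝕜 := ℝ) (x := a) (y := l.toContinuousLinearMap)
  rw [PiLp.inner_apply] at h
  simpa using h.symm

/-! ### Sublinear maps and their subdifferentials -/

section Sublinear

variable {n : ℕ} {φ : EuclideanSpace ℝ (Fin n) → ℝ}

theorem IsPosHomogeneous.map_zero (hφ : IsPosHomogeneous φ) : φ 0 = 0 := by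
  simpa using hφ 0 le_rfl 0

theorem IsSublinear.convexOn (hφ : IsSublinear φ) : ConvexOn ℝ Set.univ φ := by
  refine ⟨convex_univ, fun x _ y _ a b ha hb _ => ?_⟩
  have := hφ.2 (a • x) (b • y)
  rwa [hφ.1 a ha, hφ.1 b hb] at this

theorem IsSublinear.continuous (hφ : IsSublinear φ) : Continuous φ :=
  continuousOn_univ.1 (hφ.convexOn.continuousOn isOpen_univ)

/-- A sublinear map is supported at each point by an element of its subdifferential. -/
theorem IsSublinear.exists_mem_subdifferentialZero (hφ : IsSublinear φ)
    (x : EuclideanSpace ℝ (Fin n)) :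
    ∃ b ∈ subdifferentialZero φ, ∑ i, b i * x i = φ x := by
  have hx : ∀ c : ℝ, c • x = 0 → c • φ x = 0 := by
    intro c hc
    rcases smul_eq_zero.1 hc with rfl | rfl
    · simp
    · simp [hφ.1.map_zero]
  obtain ⟨g, hg, hle⟩ := exists_extension_of_le_sublinear
    (LinearPMap.mkSpanSingleton' x (φ x) hx) φ (fun c hc y => hφ.1 c hc.le y) hφ.2 (by
      rintro ⟨y, hy⟩
      obtain ⟨c, rfl⟩ := Submodule.mem_span_singleton.1 hy
      rw [LinearPMap.mkSpanSingleton'_apply]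
      rcases le_total 0 c with hc | hc
      · simp [hφ.1 c hc]
      · have h1 := hφ.2 (c • x) ((-c) • x)
        rw [hφ.1 (-c) (neg_nonneg.2 hc), ← add_smul, add_neg_cancel, zero_smul,
          hφ.1.map_zero] at h1
        simp only [smul_eq_mul, RingHom.id_apply]
        linarith)
  obtain ⟨b, hb⟩ := exists_forall_eq_sum_mul g
  have hb' : ∀ y, ∑ i, b i * y i = g y := fun y => by
    rw [hb]; exact Finset.sum_congr rfl fun i _ => mul_comm _ _
  refine ⟨b, fun y => (hb' y).trans_le (hle y), ?_⟩
  have h1 := hg ⟨x, Submodule.mem_span_singleton_self x⟩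
  rw [hb', ← LinearPMap.mkSpanSingleton'_apply_self (σ := RingHom.id ℝ) x (φ x) hx
    (Submodule.mem_span_singleton_self x)]
  exact h1

theorem convex_subdifferentialZero (φ : EuclideanSpace ℝ (Fin n) → ℝ) :
    Convex ℝ (subdifferentialZero φ) := by
  intro a ha b hb s t hs ht hst x
  have h : ∑ i, (s • a + t • b) i * x i = s * ∑ i, a i * x i + t * ∑ i, b i * x i := by
    simp only [PiLp.add_apply, PiLp.smul_apply, smul_eq_mul, Finset.mul_sum,
      ← Finset.sum_add_distrib]
    exact Finset.sum_congr rfl fun i _ => by ring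
  rw [h]
  calc s * ∑ i, a i * x i + t * ∑ i, b i * x i ≤ s * φ x + t * φ x := by
        gcongr
        · exact ha x
        · exact hb x
    _ = φ x := by rw [← add_mul, hst, one_mul]

/-- If at every point of the unit sphere some functional in `A` is below `φ + ε`, then some convex
combination of `A` is `ε`-close to the subdifferential of `φ`. -/
theorem exists_mem_convexHull_add_mem_subdifferentialZero (hφ : IsSublinear φ)
    {A : Set (EuclideanSpace ℝ (Fin n))} (hA : A.Nonempty) {ε : ℝ} (hε : 0 < ε)
    (hlt : ∀ x ∈ Metric.sphere (0 : EuclideanSpace ℝ (Fin n)) 1,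
      ∃ a ∈ A, ∑ i, a i * x i < φ x + ε) :
    ∃ b ∈ subdifferentialZero φ, ∃ d : EuclideanSpace ℝ (Fin n),
      ‖d‖ < ε ∧ b + d ∈ convexHull ℝ A := by
  by_contra! hcon
  obtain ⟨l, u, hl, hu⟩ := geometric_hahn_banach_open
    ((convex_subdifferentialZero φ).add (convex_ball (0 : EuclideanSpace ℝ (Fin n)) ε))
    (Metric.isOpen_ball.add_left) (convex_convexHull ℝ A) (by
      rw [Set.disjoint_left]
      rintro _ ⟨b, hb, d, hd, rfl⟩
      exact hcon b hb d (by simpa using hd))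
  obtain ⟨x, hx⟩ := exists_forall_eq_sum_mul (l : EuclideanSpace ℝ (Fin n) →ₗ[ℝ] ℝ)
  replace hx : ∀ a, l a = ∑ i, a i * x i := hx
  obtain ⟨b, hb, hbx⟩ := hφ.exists_mem_subdifferentialZero x
  obtain ⟨a₀, ha₀⟩ := hA
  have hx0 : x ≠ 0 := by
    rintro rfl
    have h1 := hl (b + 0) (Set.add_mem_add hb (Metric.mem_ball_self hε))
    have h2 := hu a₀ (subset_convexHull ℝ A ha₀)
    rw [hx] at h1 h2
    simp at h1 h2
    linarith
  have hr : 0 < ‖x‖ := norm_pos_iff.2 hx0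
  obtain ⟨a, ha, hlt'⟩ := hlt (‖x‖⁻¹ • x) (by simp [norm_smul, hr.ne'])
  have hax : l a < φ x + ε * ‖x‖ := by
    have h1 : ∑ i, a i * (‖x‖⁻¹ • x) i = ‖x‖⁻¹ * l a := by
      rw [hx, Finset.mul_sum]
      exact Finset.sum_congr rfl fun i _ => by simp; ring
    rw [h1, hφ.1 _ (inv_nonneg.2 hr.le)] at hlt'
    have h2 := mul_lt_mul_of_pos_left hlt' hr
    field_simp at h2
    linarith
  have hxx : l x = ‖x‖ ^ 2 := by
    rw [hx, EuclideanSpace.real_norm_sq_eq]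
    exact Finset.sum_congr rfl fun i _ => by ring
  -- The ball is open, so the test direction `x` is taken with a length `t` strictly between
  -- the excess of `l a` over `φ x` and `ε ‖x‖`.
  obtain ⟨t, ht1, ht2⟩ := exists_between (max_lt (show l a - φ x < ε * ‖x‖ by linarith)
    (show 0 < ε * ‖x‖ by positivity))
  have ht0 : 0 < t := (le_max_right _ _).trans_lt ht1
  have htl : l a - φ x < t := (le_max_left _ _).trans_lt ht1
  have h1 := hl (b + (t / ‖x‖ ^ 2) • x) (Set.add_mem_add hb (by
    rw [mem_ball_zero_iff, norm_smul, Real.norm_of_nonneg (by positivity)]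
    rw [show t / ‖x‖ ^ 2 * ‖x‖ = t / ‖x‖ by field_simp]
    rwa [div_lt_iff₀ hr]))
  have h2 := hu a (subset_convexHull ℝ A ha)
  rw [map_add, map_smul, hxx, hx b, hbx, smul_eq_mul, div_mul_cancel₀ _ (by positivity)] at h1
  linarith

/-- Finitely many members of a family with infimum `h` come within `ε` of a continuous
majorant of `h` at every point of the unit sphere. -/
theorem IsInfSublinearRep.exists_finset_lt_add {h : EuclideanSpace ℝ (Fin n) → ℝ}
    {Ξ : Set (EuclideanSpace ℝ (Fin n) → ℝ)} (hΞ : IsInfSublinearRep h Ξ) (hφ : Continuous φ)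
    (hle : ∀ x, h x ≤ φ x) {ε : ℝ} (hε : 0 < ε) :
    ∃ t : Finset (EuclideanSpace ℝ (Fin n) → ℝ), (t : Set _) ⊆ Ξ ∧ t.Nonempty ∧
      ∀ x ∈ Metric.sphere (0 : EuclideanSpace ℝ (Fin n)) 1, ∃ ξ ∈ t, ξ x < φ x + ε := by
  classical
  have hex : ∀ x, ∃ ξ ∈ Ξ, ξ x < φ x + ε := by
    intro x
    obtain ⟨_, ⟨ξ, hξ, rfl⟩, h1⟩ := (isGLB_lt_iff (hΞ.2 x)).1
      (show h x < φ x + ε by linarith [hle x])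
    exact ⟨ξ, hξ, h1⟩
  obtain ⟨ξ₀, hξ₀, -⟩ := hex 0
  obtain ⟨t, ht⟩ := (isCompact_sphere (0 : EuclideanSpace ℝ (Fin n)) 1).elim_finite_subcover
    (fun ξ : Ξ => {x | ξ.1 x < φ x + ε})
    (fun ξ => isOpen_lt (hΞ.1 ξ.1 ξ.2).continuous (hφ.add continuous_const))
    (fun x _ => by
      obtain ⟨ξ, hξ, h1⟩ := hex x
      exact Set.mem_iUnion.2 ⟨⟨ξ, hξ⟩, h1⟩)
  -- On `ℝ⁰` the sphere is empty and so may be its subcover; `ξ₀` keeps the family nonempty.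
  refine ⟨insert ξ₀ (t.image Subtype.val), ?_, Finset.insert_nonempty _ _, fun x hx => ?_⟩
  · intro ξ hξ
    simp only [Finset.coe_insert, Finset.coe_image, Set.mem_insert_iff, Set.mem_image] at hξ
    rcases hξ with rfl | ⟨η, -, rfl⟩
    · exact hξ₀
    · exact η.2
  · obtain ⟨ξ, hξ, h1⟩ := Set.mem_iUnion₂.1 (ht hx)
    exact ⟨ξ.1, Finset.mem_insert_of_mem (Finset.mem_image_of_mem _ hξ), h1⟩

end Sublinear

/-! ### Sublinear calculus in Archimedean vector lattices -/

section VectorLattice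

variable {E : Type*} [AddCommGroup E] [Lattice E] [IsOrderedAddMonoid E]

/-- Infinite distributivity in a lattice-ordered group. -/
theorem IsLUB.inf_le_of_forall_inf_le {S : Set E} {u x z : E} (hu : IsLUB S u)
    (hz : ∀ s ∈ S, x ⊓ s ≤ z) : x ⊓ u ≤ z := by
  have h1 : u ≤ z + x ⊔ u - x := hu.2 fun s hs => by
    -- `s = x ⊓ s + x ⊔ s - x`, and `x ⊔ s ≤ x ⊔ u`.
    have h2 : s = x ⊓ s + x ⊔ s - x := by rw [inf_add_sup]; abel
    rw [h2]
    gcongr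
    · exact hz s hs
    · exact hu.1 hs
  have h3 : x ⊓ u = u + x - x ⊔ u := by rw [add_comm u, ← inf_add_sup x u]; abel
  rw [h3]
  calc u + x - x ⊔ u ≤ (z + x ⊔ u - x) + x - x ⊔ u := by gcongr
    _ = z := by abel

theorem IsArchimedeanVL.le_of_forall_le_add [Module ℝ E] [IsOrderedModule ℝ E]
    (hE : IsArchimedeanVL E) {g c e : E} (h : ∀ ε : ℝ, 0 < ε → g ≤ c + ε • e) (he : 0 ≤ e) :
    g ≤ c := by
  refine sub_nonpos.1 (sup_eq_right.1 (hE ((g - c) ⊔ 0) e le_sup_right fun k => ?_))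
  rcases Nat.eq_zero_or_pos k with rfl | hk
  · simpa using he
  have hk' : (0 : ℝ) < k := Nat.cast_pos.2 hk
  have h1 : (g - c) ⊔ 0 ≤ (k : ℝ)⁻¹ • e :=
    sup_le (sub_le_iff_le_add'.2 (h _ (inv_pos.2 hk'))) (smul_nonneg (inv_pos.2 hk').le he)
  have h2 := smul_le_smul_of_nonneg_left h1 hk'.le
  rwa [smul_inv_smul₀ hk'.ne', Nat.cast_smul_eq_nsmul] at h2

variable [Module ℝ E] {n : ℕ} {f : Fin n → E}

/-- To bound a common lower bound `g` of finitely many `ξ(f)`, it suffices to bound, for every choice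
of subgradients `s ξ`, the common lower bounds of `g` and the elements `∑ i, s ξ i • f i`. -/
theorem le_of_forall_subgradient_choice {g c : E} (t : Finset (EuclideanSpace ℝ (Fin n) → ℝ))
    (hg : ∀ ξ ∈ t, ∃ u, IsSublinearValue ξ f u ∧ g ≤ u)
    (hc : ∀ s : (EuclideanSpace ℝ (Fin n) → ℝ) → EuclideanSpace ℝ (Fin n),
      (∀ ξ ∈ t, s ξ ∈ subdifferentialZero ξ) →
      ∀ y ≤ g, (∀ ξ ∈ t, y ≤ coordCombination f (s ξ)) → y ≤ c) : g ≤ c := by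
  classical
  induction t using Finset.induction_on with
  | empty => exact hc (fun _ => 0) (by simp) g le_rfl (by simp)
  | insert ξ₀ t hξ₀ ih =>
    refine ih (fun ξ hξ => hg ξ (Finset.mem_insert_of_mem hξ)) fun s hs y hy hys => ?_
    obtain ⟨u, hu, hgu⟩ := hg ξ₀ (Finset.mem_insert_self _ _)
    rw [← inf_eq_left.2 (hy.trans hgu)]
    refine IsLUB.inf_le_of_forall_inf_le hu ?_
    rintro _ ⟨a, ha, rfl⟩
    have hne : ∀ ξ ∈ t, ξ ≠ ξ₀ := fun ξ hξ h => hξ₀ (h ▸ hξ)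
    refine hc (Function.update s ξ₀ a) ?_ _ (inf_le_left.trans hy) ?_
    · intro ξ hξ
      rcases Finset.mem_insert.1 hξ with rfl | hξ
      · simpa using ha
      · simpa [hne ξ hξ] using hs ξ hξ
    · intro ξ hξ
      rcases Finset.mem_insert.1 hξ with rfl | hξ
      · simp [coordCombination_apply]
      · simpa [hne ξ hξ] using inf_le_left.trans (hys ξ hξ)

variable [IsOrderedModule ℝ E]

theorem coordCombination_le_smul_sum_abs (f : Fin n → E) {d : EuclideanSpace ℝ (Fin n)} {ε : ℝ}
    (hd : ‖d‖ ≤ ε) : coordCombination f d ≤ ε • ∑ i, |f i| := by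
  rw [coordCombination_apply, Finset.smul_sum]
  refine Finset.sum_le_sum fun i _ => ?_
  have hi : |d i| ≤ ε := (PiLp.norm_apply_le d i).trans hd
  have h1 : d i • f i ≤ |d i| • |f i| := by
    rcases le_total 0 (d i) with h | h
    · rw [abs_of_nonneg h]
      exact smul_le_smul_of_nonneg_left (le_abs_self _) h
    · rw [abs_of_nonpos h, ← neg_smul_neg]
      exact smul_le_smul_of_nonneg_left (neg_le_abs _) (neg_nonneg.2 h)
  exact h1.trans (smul_le_smul_of_nonneg_right hi (abs_nonneg _))

theorem convex_setOf_le_map {V : Type*} [AddCommGroup V] [Module ℝ V] (L : V →ₗ[ℝ] E) (y : E) :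
    Convex ℝ {a | y ≤ L a} :=
  (convex_Ici y).linear_preimage L

/-- A lower bound of the values `ξ(f)`, `ξ ∈ Ξ`, lies below `φ(f)` for each sublinear `φ` that
majorizes the pointwise infimum of `Ξ`. -/
theorem IsInfSublinearRep.le_of_mem_lowerBounds (hE : IsArchimedeanVL E)
    {h : EuclideanSpace ℝ (Fin n) → ℝ} {Ξ : Set (EuclideanSpace ℝ (Fin n) → ℝ)}
    (hΞ : IsInfSublinearRep h Ξ) (hdef : ∀ ξ ∈ Ξ, SublinearDefined ξ f) {g : E}
    (hg : g ∈ lowerBounds (sublinearValues Ξ f)) {φ : EuclideanSpace ℝ (Fin n) → ℝ}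
    (hφ : IsSublinear φ) (hle : ∀ x, h x ≤ φ x) {v : E} (hv : IsSublinearValue φ f v) :
    g ≤ v := by
  refine hE.le_of_forall_le_add (e := ∑ i, |f i|) (fun ε hε => ?_)
    (Finset.sum_nonneg fun i _ => abs_nonneg _)
  obtain ⟨t, htΞ, ⟨ξ₀, hξ₀⟩, ht⟩ := hΞ.exists_finset_lt_add hφ.continuous hle hε
  refine le_of_forall_subgradient_choice (f := f) t (fun ξ hξ => ?_) fun s hs y _ hy => ?_
  · obtain ⟨u, hu⟩ := hdef ξ (htΞ hξ)
    exact ⟨u, hu, hg ⟨ξ, htΞ hξ, hu⟩⟩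
  · obtain ⟨b, hb, d, hd, hbd⟩ := exists_mem_convexHull_add_mem_subdifferentialZero hφ
      (A := s '' t) ⟨_, ξ₀, hξ₀, rfl⟩ hε fun x hx => by
        obtain ⟨ξ, hξ, hlt⟩ := ht x hx
        exact ⟨s ξ, ⟨ξ, hξ, rfl⟩, (hs ξ hξ x).trans_lt hlt⟩
    have hsub : s '' t ⊆ {a | y ≤ coordCombination f a} := by
      rintro _ ⟨ξ, hξ, rfl⟩
      exact hy ξ hξ
    have h1 : y ≤ coordCombination f (b + d) :=
      convexHull_min hsub (convex_setOf_le_map _ y) hbd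
    rw [map_add] at h1
    exact h1.trans (add_le_add (hv.1 ⟨b, hb, rfl⟩) (coordCombination_le_smul_sum_abs f hd.le))

theorem lowerBounds_sublinearValues_subset (hE : IsArchimedeanVL E)
    {h : EuclideanSpace ℝ (Fin n) → ℝ} {Φ Ξ : Set (EuclideanSpace ℝ (Fin n) → ℝ)}
    (hΦ : IsInfSublinearRep h Φ) (hΞ : IsInfSublinearRep h Ξ)
    (hdef : ∀ ξ ∈ Ξ, SublinearDefined ξ f) :
    lowerBounds (sublinearValues Ξ f) ⊆ lowerBounds (sublinearValues Φ f) := by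
  rintro g hg v ⟨φ, hφ, hv⟩
  exact hΞ.le_of_mem_lowerBounds hE hdef hg (hΦ.1 φ hφ)
    (fun x => (hΦ.2 x).1 ⟨φ, hφ, rfl⟩) hv

theorem isGLB_sublinearValues_congr (hE : IsArchimedeanVL E)
    {h : EuclideanSpace ℝ (Fin n) → ℝ} {Φ Ξ : Set (EuclideanSpace ℝ (Fin n) → ℝ)}
    (hΦ : IsInfSublinearRep h Φ) (hΞ : IsInfSublinearRep h Ξ)
    (hdΦ : ∀ φ ∈ Φ, SublinearDefined φ f) (hdΞ : ∀ ξ ∈ Ξ, SublinearDefined ξ f) {g : E}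
    (hg : IsGLB (sublinearValues Φ f) g) : IsGLB (sublinearValues Ξ f) g := by
  rwa [IsGLB, (lowerBounds_sublinearValues_subset hE hΞ hΦ hdΦ).antisymm'
    (lowerBounds_sublinearValues_subset hE hΦ hΞ hdΞ)]

end VectorLattice

/-! ### Duality between superlinear and sublinear maps -/

section Negation

open scoped Pointwise

variable {n : ℕ}

theorem IsSuperlinear.neg {ψ : EuclideanSpace ℝ (Fin n) → ℝ} (hψ : IsSuperlinear ψ) :
    IsSublinear (-ψ) := by
  refine ⟨fun c hc x => ?_, fun x y => ?_⟩
  · simp [hψ.1 c hc x]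
  · have := hψ.2 x y
    simp only [Pi.neg_apply]
    linarith

theorem superdifferentialZero_eq_neg (ψ : EuclideanSpace ℝ (Fin n) → ℝ) :
    superdifferentialZero ψ = -subdifferentialZero (-ψ) := by
  ext a
  simp [superdifferentialZero, subdifferentialZero]

theorem IsSupSuperlinearRep.neg {h : EuclideanSpace ℝ (Fin n) → ℝ}
    {Ψ : Set (EuclideanSpace ℝ (Fin n) → ℝ)} (hΨ : IsSupSuperlinearRep h Ψ) :
    IsInfSublinearRep (-h) (-Ψ) := by
  refine ⟨fun φ hφ => by simpa using (hΨ.1 (-φ) hφ).neg, fun x => ?_⟩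
  have h1 : (fun φ : EuclideanSpace ℝ (Fin n) → ℝ => φ x) '' (-Ψ) = -((fun ψ => ψ x) '' Ψ) := by
    ext r
    simp only [Set.mem_image, Set.mem_neg]
    constructor
    · rintro ⟨φ, hφ, rfl⟩
      exact ⟨-φ, hφ, rfl⟩
    · rintro ⟨ψ, hψ, hr⟩
      exact ⟨-ψ, by simpa using hψ, by simp [hr]⟩
  rw [h1, Pi.neg_apply]
  exact (hΨ.2 x).neg

variable {E : Type*} [AddCommGroup E] [Lattice E] [IsOrderedAddMonoid E] [Module ℝ E]
  {f : Fin n → E}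

theorem isSuperlinearValue_iff_neg {ψ : EuclideanSpace ℝ (Fin n) → ℝ} {g : E} :
    IsSuperlinearValue ψ f g ↔ IsSublinearValue (-ψ) f (-g) := by
  have h : (fun a : EuclideanSpace ℝ (Fin n) => ∑ i, a i • f i) '' superdifferentialZero ψ =
      -((fun a : EuclideanSpace ℝ (Fin n) => ∑ i, a i • f i) '' subdifferentialZero (-ψ)) := by
    rw [superdifferentialZero_eq_neg]
    exact Set.image_neg_of_apply_neg_eq_neg fun a _ => (coordCombination f).map_neg a
  rw [IsSuperlinearValue, IsSublinearValue, ← isGLB_neg', h, neg_neg]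

theorem superlinearValues_eq_neg (Ψ : Set (EuclideanSpace ℝ (Fin n) → ℝ)) (f : Fin n → E) :
    superlinearValues Ψ f = -sublinearValues (-Ψ) f := by
  ext g
  simp only [superlinearValues, sublinearValues, Set.mem_neg, Set.mem_ofPred_eq,
    isSuperlinearValue_iff_neg]
  constructor
  · rintro ⟨ψ, hψ, h⟩
    exact ⟨-ψ, by simpa using hψ, h⟩
  · rintro ⟨φ, hφ, h⟩
    exact ⟨-φ, hφ, by simpa using h⟩

theorem isLUB_superlinearValues_iff_neg {Ψ : Set (EuclideanSpace ℝ (Fin n) → ℝ)} {g : E} :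
    IsLUB (superlinearValues Ψ f) g ↔ IsGLB (sublinearValues (-Ψ) f) (-g) := by
  rw [superlinearValues_eq_neg, ← isLUB_neg', neg_neg]

theorem SuperlinearDefined.neg {ψ : EuclideanSpace ℝ (Fin n) → ℝ}
    (h : SuperlinearDefined ψ f) : SublinearDefined (-ψ) f :=
  h.imp' Neg.neg fun _ => isSuperlinearValue_iff_neg.1

end Negation

theorem proposition6p3 {E : Type*} [AddCommGroup E] [Lattice E] [IsOrderedAddMonoid E]
    [Module ℝ E] [IsOrderedModule ℝ E] (hE : IsArchimedeanVL E)
    {n : ℕ} (hn : 0 < n) (h : EuclideanSpace ℝ (Fin n) → ℝ)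
    (hhom : IsPosHomogeneous h) (hbdd : IsBoundedOnUnitSphere h) (f : Fin n → E) :
    (UpperSemicontinuous h →
      ∀ Φ Ξ : Set (EuclideanSpace ℝ (Fin n) → ℝ),
        IsInfSublinearRep h Φ → IsInfSublinearRep h Ξ →
        (∀ φ ∈ Φ, SublinearDefined φ f) → (∀ ξ ∈ Ξ, SublinearDefined ξ f) →
        (∃ g : E, IsGLB (sublinearValues Φ f) g) →
        ∃ g : E, IsGLB (sublinearValues Φ f) g ∧ IsGLB (sublinearValues Ξ f) g) ∧
    (LowerSemicontinuous h →
      ∀ Ψ Ξ : Set (EuclideanSpace ℝ (Fin n) → ℝ),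
        IsSupSuperlinearRep h Ψ → IsSupSuperlinearRep h Ξ →
        (∀ ψ ∈ Ψ, SuperlinearDefined ψ f) → (∀ ξ ∈ Ξ, SuperlinearDefined ξ f) →
        (∃ g : E, IsLUB (superlinearValues Ψ f) g) →
        ∃ g : E, IsLUB (superlinearValues Ψ f) g ∧ IsLUB (superlinearValues Ξ f) g) := by
  refine ⟨fun _ Φ Ξ hΦ hΞ hdΦ hdΞ ⟨g, hg⟩ =>
    ⟨g, hg, isGLB_sublinearValues_congr hE hΦ hΞ hdΦ hdΞ hg⟩,
    fun _ Ψ Ξ hΨ hΞ hdΨ hdΞ ⟨g, hg⟩ => ⟨g, hg, ?_⟩⟩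
  rw [isLUB_superlinearValues_iff_neg] at hg ⊢
  exact isGLB_sublinearValues_congr hE hΨ.neg hΞ.neg
    (fun φ hφ => by simpa using (hdΨ (-φ) hφ).neg)
    (fun ξ hξ => by simpa using (hdΞ (-ξ) hξ).neg) hg
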